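/- Let $0<q<1$, $a>0$, $0<\alpha<1$, $A_{q,a}=\{aq^n:n\in\mathbb N_0\}$ and $A^*_{q,a}=A_{q,a}\cup\{0\}$. Write $(z;q)_\infty=\prod_{i\ge0}(1-zq^i)$, $(z;q)_\nu=(z;q)_\infty/(zq^\nu;q)_\infty$, $\Gamma_q(x)=\frac{(q;q)_\infty}{(q^x;q)_\infty}(1-q)^{1-x}$, $\int_0^b f\,d_qt=(1-q)b\sum_{n\ge0}q^nf(bq^n)$, $\int_b^c=\int_0^c-\int_0^b$, $D_qf(x)=\frac{f(x)-f(qx)}{(1-q)x}$ and $D_{q^{-1}}f(x)=\frac{f(x)-f(x/q)}{x-x/q}$ for $x\ne0$, $D_{q^{-1}}f(0)=\lim_n\frac{f(aq^n)-f(0)}{aq^n}$, and, for $\beta>0$, $$I^\beta_{q,0^+}f(x)=\tfrac{x^{\beta-1}}{\Gamma_q(\beta)}\int_0^x(qt/x;q)_{\beta-1}f(t)\,d_qt,\qquad I^\beta_{q,a^-}f(x)=\tfrac1{\Gamma_q(\beta)}\int_{qx}^a t^{\beta-1}(qx/t;q)_{\beta-1}f(t)\,d_qt,$$ $I^\beta_{q,0^+}f(0)=0$,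 ${}^cD^\alpha_{q,0^+}f=I^{1-\alpha}_{q,0^+}D_qf$, $D^\alpha_{q,a^-}f=-\frac1qD_{q^{-1}}I^{1-\alpha}_{q,a^-}f$. Let $C(A^*_{q,a})$ be the space of functions $f$ on $A^*_{q,a}$ that are $q$-regular at zero, i.e. $\lim_nf(xq^n)=f(0)$ for all $x\in A^*_{q,a}$, and let $\mathcal{AC}_q(A^*_{q,a})$ be the set of those $f\in C(A^*_{q,a})$ for which $\sum_{j\ge0}|f(uq^j)-f(uq^{j+1})|$ is bounded uniformly in $u\in A^*_{q,a}$ (the domain of ${}^cD^\alpha_{q,0^+}$). For a bounded function $f$ on $A^*_{q,a}$ put $\|f\|=\sup_{A^*_{q,a}}|f|$. Let $p,r,w_\alpha$ be real functions on $A^*_{q,a}$ with $p\neq0$ and $w_\alpha>0$ there, and let $c_1,c_2,d_1,d_2\in\mathbb R$ with $c_1^2+c_2^2\ne0$ and $d_1^2+d_2^2\neq0$. For a scalar $\lambda$ consider the problem $$D^\alpha_{q,a^-}\big(p\,{}^cD^\alpha_{q,0^+}y\big)(x)+r(x)y(x)-\lambda w_\alpha(x)y(x)=0,\quad x\in A^*_{q,a},\qquad(3.1)$$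 $$c_1y(0)+c_2\,u_y(0)=0,\quad(3.2)\qquad d_1y(a)+d_2\,u_y(a/q)=0,\quad(3.3)$$ where $u_y=I^{1-\alpha}_{q,a^-}(p\,{}^cD^\alpha_{q,0^+}y)$. A solution is a function $y\in\mathcal{AC}_q(A^*_{q,a})\subset C(A^*_{q,a})$ satisfying (3.1)–(3.3). The value $u_y(a/q)$, which enters (3.3) and also (3.1) at $x=a$, lies outside $A^*_{q,a}$; it is either (i) given by the defining $q$-integral (so that it is $0$), or (ii) an additional boundary value attached to the solution: $y$ is a solution if there is some value $u_y(a/q)$ for which (3.1)–(3.3) hold. Functions $y$ and $\lambda$ are real, or both are complex. Put $\phi=I^\alpha_{q,0^+}I^\alpha_{q,a^-}1$, $\ \psi=I^\alpha_{q,0^+}\Big[\dfrac{a^{\alpha-1}(qx/a;q)_{\alpha-1}}{\Gamma_q(\alpha)p(x)}\Big]$, $\ \Delta=c_1d_2-c_2d_1+c_1d_1\psi(a)$, and, when $\Delta\neq0$, $$A=\Big\|\tfrac{c_2}{\Delta}\big[d_2+d_1(\psi(a)-\psi(\cdot))\big]\Big\|,\quad B=\Big\|\tfrac{d_1}{\Delta}\big[c_1\psi(\cdot)-c_2\big]\Big\|,\quad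 M_\phi=\|\phi\|,\quad m_p=\inf_{x\in A_{q,a}}|p(x)|.$$ Theorem. Assume $\Delta\ne0$, and let $\lambda$ be such that $r-\lambda w_\alpha$ is bounded on $A^*_{q,a}$ and $$\|r-\lambda w_\alpha\|<\frac{m_p}{M_\phi+B\,\phi(a)+A\,a\,m_p}.$$ Then, for each of the readings (i) and (ii) of $u_y(a/q)$, the problem (3.1)–(3.3) has exactly one solution $y_\lambda$ that is $q$-regular at zero on $A^*_{q,a}$; and if such a $\lambda$ is an eigenvalue (there is a nontrivial solution), it is simple: any two eigenfunctions are proportional. -/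

import Mathlib

open Filter Topology

namespace QFSLP

noncomputable section

/-- The set `A_{q,a} = {a qⁿ : n ∈ ℕ₀}`. -/
def grid (q a : ℝ) : Set ℝ := {x | ∃ n : ℕ, x = a * q ^ n}

/-- The set `A*_{q,a} = A_{q,a} ∪ {0}`. -/
def gridStar (q a : ℝ) : Set ℝ := grid q a ∪ {0}

/-- `(z; q)_∞`. -/
def qPochInf (q z : ℝ) : ℝ := ∏' i : ℕ, (1 - z * q ^ i)

/-- `(z; q)_ν = (z; q)_∞ / (z q^ν; q)_∞` for real `ν`. -/
def qPoch (q z ν : ℝ) : ℝ := qPochInf q z / qPochInf q (z * q ^ ν)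

/-- The `q`-gamma function `Γ_q(x) = (q; q)_∞ / (q^x; q)_∞ (1 - q)^{1 - x}`. -/
def qGamma (q x : ℝ) : ℝ := qPochInf q q / qPochInf q (q ^ x) * (1 - q) ^ (1 - x)

section Operators

variable {E : Type*} [NormedAddCommGroup E] [NormedSpace ℝ E]

/-- The Jackson integral `∫₀ᵇ f(t) d_q t = (1 - q) b ∑ qⁿ f(b qⁿ)`. -/
def jackson₀ (q b : ℝ) (f : ℝ → E) : E := ((1 - q) * b) • ∑' n : ℕ, q ^ n • f (b * q ^ n)

/-- The Jackson integral `∫_b^c f(t) d_q t`. -/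
def jackson (q b c : ℝ) (f : ℝ → E) : E := jackson₀ q c f - jackson₀ q b f

/-- Jackson's derivative `D_q f(x)` at `x ≠ 0`
(the value at zero never enters the operators below). -/
def qDeriv (q : ℝ) (f : ℝ → E) (x : ℝ) : E := ((1 - q) * x)⁻¹ • (f x - f (q * x))

/-- `d` is the value of `D_{q⁻¹} f` at the point `x` of `A*_{q,a}`: the difference quotient of `f`
at `x` and `x / q` if `x ≠ 0`, and the limit of `(f(a qⁿ) - f(0)) / (a qⁿ)` if `x = 0`. -/
def HasQInvDerivAt (q a : ℝ) (f : ℝ → E) (d : E) (x : ℝ) : Prop :=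
  (x ≠ 0 → d = (x - x / q)⁻¹ • (f x - f (x / q))) ∧
  (x = 0 → Tendsto (fun n : ℕ => (a * q ^ n)⁻¹ • (f (a * q ^ n) - f 0)) atTop (𝓝 d))

/-- The left sided Riemann–Liouville operator
`I_{q,0⁺}^β f(x) = x^{β-1} / Γ_q(β) ∫₀ˣ (qt/x; q)_{β-1} f(t) d_q t`. -/
def leftInt (q β : ℝ) (f : ℝ → E) (x : ℝ) : E :=
  (x ^ (β - 1) / qGamma q β) • jackson q 0 x (fun t => qPoch q (q * t / x) (β - 1) • f t)

/-- The right sided Riemann–Liouville operator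
`I_{q,a⁻}^β f(x) = 1 / Γ_q(β) ∫_{qx}^a t^{β-1} (qx/t; q)_{β-1} f(t) d_q t`. -/
def rightInt (q a β : ℝ) (f : ℝ → E) (x : ℝ) : E :=
  (1 / qGamma q β) •
    jackson q (q * x) a (fun t => (t ^ (β - 1) * qPoch q (q * x / t) (β - 1)) • f t)

/-- The left sided Caputo derivative of order `0 < α < 1`,
`ᶜD_{q,0⁺}^α f = I_{q,0⁺}^{1-α} D_q f`. -/
def leftCaputo (q α : ℝ) (f : ℝ → E) : ℝ → E := leftInt q (1 - α) (qDeriv q f)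

/-- `f` is `q`-regular at zero on `A*_{q,a}`, i.e. `f ∈ C(A*_{q,a})`. -/
def QRegular (q a : ℝ) (f : ℝ → E) : Prop :=
  ∀ x ∈ gridStar q a, Tendsto (fun n : ℕ => f (x * q ^ n)) atTop (𝓝 (f 0))

/-- `f` is `q`-absolutely continuous on `A*_{q,a}`, i.e. `f ∈ 𝒜𝒞_q(A*_{q,a})`; for `0 < α < 1` this
is the domain of the left sided Caputo derivative. -/
def QAbsCont (q a : ℝ) (f : ℝ → E) : Prop :=
  QRegular q a f ∧ ∃ K : ℝ, ∀ u ∈ gridStar q a, ∀ N : ℕ,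
    ∑ j ∈ Finset.range N, ‖f (u * q ^ j) - f (u * q ^ (j + 1))‖ ≤ K

/-- The norm `‖f‖ = sup {|f(x qⁿ)| : x ∈ A*_{q,a}, n ∈ ℕ₀}` (for `f` bounded on `A*_{q,a}`). -/
def supNorm (q a : ℝ) (f : ℝ → E) : ℝ :=
  sSup {s | ∃ x ∈ gridStar q a, ∃ n : ℕ, s = ‖f (x * q ^ n)‖}

end Operators

/-- `m_p = inf {|p(x)| : x ∈ A_{q,a}}`. -/
def mInf (q a : ℝ) (p : ℝ → ℝ) : ℝ := sInf {s | ∃ x ∈ grid q a, s = |p x|}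

/-- `φ = I_{q,0⁺}^α I_{q,a⁻}^α 1`. -/
def phi (q a α : ℝ) : ℝ → ℝ := leftInt q α (rightInt q a α (fun _ => (1 : ℝ)))

/-- `ψ_{α,a} = I_{q,0⁺}^α [a^{α-1} (qx/a; q)_{α-1} / (Γ_q(α) p(x))]`. -/
def psi (q a α : ℝ) (p : ℝ → ℝ) : ℝ → ℝ :=
  leftInt q α (fun x => a ^ (α - 1) * qPoch q (q * x / a) (α - 1) / (qGamma q α * p x))

/-- `Δ = c₁ d₂ - c₂ d₁ + c₁ d₁ ψ_{α,a}(a)`. -/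
def bdet (q a α : ℝ) (p : ℝ → ℝ) (c₁ c₂ d₁ d₂ : ℝ) : ℝ :=
  c₁ * d₂ - c₂ * d₁ + c₁ * d₁ * psi q a α p a

/-- `A(x) = c₂ / Δ [d₂ + d₁ (ψ_{α,a}(a) - ψ_{α,a}(x))]`. -/
def coefA (q a α : ℝ) (p : ℝ → ℝ) (c₁ c₂ d₁ d₂ : ℝ) (x : ℝ) : ℝ :=
  c₂ / bdet q a α p c₁ c₂ d₁ d₂ * (d₂ + d₁ * (psi q a α p a - psi q a α p x))

/-- `B(x) = d₁ / Δ [c₁ ψ_{α,a}(x) - c₂]`. -/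
def coefB (q a α : ℝ) (p : ℝ → ℝ) (c₁ c₂ d₁ d₂ : ℝ) (x : ℝ) : ℝ :=
  d₁ / bdet q a α p c₁ c₂ d₁ d₂ * (c₁ * psi q a α p x - c₂)

section Problem

variable {𝕜 : Type*} [RCLike 𝕜]

/-- The function `I_{q,a⁻}^{1-α} (p ᶜD_{q,0⁺}^α y)`. -/
def flux (q a α : ℝ) (p : ℝ → ℝ) (y : ℝ → 𝕜) : ℝ → 𝕜 :=
  rightInt q a (1 - α) (fun t => p t • leftCaputo q α y t)

/-- The fractional `q`-Sturm–Liouville equation on `A*_{q,a}` with both boundary conditions, for `y`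
in the domain of the operator, where `u` stands for `I_{q,a⁻}^{1-α} (p ᶜD_{q,0⁺}^α y)`, so that
`-(1/q) D_{q⁻¹} u` is the right sided Riemann–Liouville derivative
`D_{q,a⁻}^α (p ᶜD_{q,0⁺}^α y)`. -/
def SolvesWith (q a : ℝ) (r w : ℝ → ℝ) (c₁ c₂ d₁ d₂ : ℝ) (lam : 𝕜)
    (u y : ℝ → 𝕜) : Prop :=
  QAbsCont q a y ∧
  (∀ x ∈ gridStar q a, ∃ d : 𝕜, HasQInvDerivAt q a u d x ∧
    (-(1 / q)) • d + r x • y x - lam * (w x • y x) = 0) ∧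
  c₁ • y 0 + c₂ • u 0 = 0 ∧
  d₁ • y a + d₂ • u (a / q) = 0

/-- Solutions of the regular problem, with the right sided operator at the point `a / q` (which lies
outside `A*_{q,a}`) evaluated by its defining integral `∫_a^a`, that is, with value `0`. -/
def IsSolution (q a α : ℝ) (p r w : ℝ → ℝ) (c₁ c₂ d₁ d₂ : ℝ) (lam : 𝕜) (y : ℝ → 𝕜) : Prop :=
  SolvesWith q a r w c₁ c₂ d₁ d₂ lam (flux q a α p y) y

/-- Solutions of the regular problem, where `I_{q,a⁻}^{1-α} (p ᶜD_{q,0⁺}^α y)` is prescribed on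
`A*_{q,a}` only and its value at the outer point `a / q` is a boundary datum of the solution. -/
def IsSolutionExt (q a α : ℝ) (p r w : ℝ → ℝ) (c₁ c₂ d₁ d₂ : ℝ) (lam : 𝕜) (y : ℝ → 𝕜) : Prop :=
  ∃ u : ℝ → 𝕜, Set.EqOn u (flux q a α p y) (gridStar q a) ∧
    SolvesWith q a r w c₁ c₂ d₁ d₂ lam u y

/-- A problem for functions on `A*_{q,a}` has exactly one solution. -/
def UniquelySolvable (q a : ℝ) (Sol : (ℝ → 𝕜) → Prop) : Prop :=
  ∃ y, Sol y ∧ ∀ z, Sol z → Set.EqOn z y (gridStar q a)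

/-- `y` is a solution that is nontrivial on `A*_{q,a}`. -/
def IsEigenfunction (q a : ℝ) (Sol : (ℝ → 𝕜) → Prop) (y : ℝ → 𝕜) : Prop :=
  Sol y ∧ ∃ x ∈ gridStar q a, y x ≠ 0

/-- If there are nontrivial solutions, they are unique up to a constant factor. -/
def SimpleIfEigenvalue (q a : ℝ) (Sol : (ℝ → 𝕜) → Prop) : Prop :=
  ∀ y z, IsEigenfunction q a Sol y → IsEigenfunction q a Sol z →
    ∃ k : 𝕜, Set.EqOn z (fun x => k * y x) (gridStar q a)

end Problem

end

end QFSLP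

/-! The problem is homogeneous, so the zero function solves it under both readings. Everything
reduces to showing that it is the only solution; simplicity is then vacuous, since no such λ is an
eigenvalue. Reading (i) is the case of reading (ii) in which the outer value is that of the flux
itself, so uniqueness is proved for (ii) alone.

On the grid both fractional integrals are sums with weights `qCoef q (q ^ β)`, and their composition
rules for orders α and 1 - α come from one identity, `sum_antidiagonal_qCoef`: the product of two
q-binomial series is the geometric series. It yields the inversion y - y(0) = I^α cD^α y
(`leftInt_leftCaputo`) and the composition law for right integrals (`sum_qCoef_smul_sum`).

Let u be the flux and U = u(a/q). Summing the equation along the grid expresses u through U and the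
q-integral of f = (r - λw)y. Undoing the right integral of order 1 - α
(`SolvesWith.mul_leftCaputo_eq`), dividing by p and applying the left integral gives y = y(0) + ψU -
T, where T = I^α[p⁻¹ I^α f] with the right integral inside. The boundary conditions form a linear
system for y(0) and U with determinant Δ, whence y = A(x)(U - u(0)) + B(x)T(a) - T(x)
(`SolvesWith.apply_eq_coef`).

If |f| ≤ N, then |T| ≤ (N/m_p)φ and |U - u(0)| ≤ aN. So the supremum S of |y| over the grid
satisfies S ≤ κS, and the smallness hypothesis says exactly κ < 1. -/

open Filter Topology

namespace QFSLP

noncomputable section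

/-! ### q-binomial coefficients and a q-Vandermonde identity -/

/-- The coefficients `(x; q)_m / (q; q)_m` of the `q`-binomial series. -/
def qCoef (q x : ℝ) (m : ℕ) : ℝ := ∏ i ∈ Finset.range m, (1 - x * q ^ i) / (1 - q ^ (i + 1))

theorem qCoef_zero (q x : ℝ) : qCoef q x 0 = 1 := by simp [qCoef]

theorem one_sub_pow_succ_pos {q : ℝ} (hq₀ : 0 < q) (hq₁ : q < 1) (n : ℕ) : 0 < 1 - q ^ (n + 1) :=
  sub_pos.2 (pow_lt_one₀ hq₀.le hq₁ n.succ_ne_zero)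

theorem qCoef_succ_mul {q : ℝ} (hq₀ : 0 < q) (hq₁ : q < 1) (x : ℝ) (n : ℕ) :
    qCoef q x (n + 1) * (1 - q ^ (n + 1)) = qCoef q x n * (1 - x * q ^ n) := by
  rw [qCoef, Finset.prod_range_succ, ← qCoef, mul_assoc,
    div_mul_cancel₀ _ (one_sub_pow_succ_pos hq₀ hq₁ n).ne']

theorem qCoef_nonneg {q x : ℝ} (hq₀ : 0 < q) (hq₁ : q < 1) (hx : x ≤ 1) (n : ℕ) :
    0 ≤ qCoef q x n := by
  refine Finset.prod_nonneg fun i _ => div_nonneg ?_ (one_sub_pow_succ_pos hq₀ hq₁ i).le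
  have h := mul_le_mul_of_nonneg_right hx (pow_pos hq₀ i).le
  have := pow_le_one₀ (n := i) hq₀.le hq₁.le
  linarith

section PowerSeries

open PowerSeries

/-- The power series `∑ (x; q)_m / (q; q)_m zᵐ`. -/
def qBinomSeries (q x : ℝ) : PowerSeries ℝ := PowerSeries.mk (qCoef q x)

/-- Comparing coefficients leaves the recursion `qCoef_succ_mul`. This is the functional equation of
(xz;q)_∞/(z;q)_∞, used formally so that no convergence question arises. -/
theorem one_sub_X_mul_qBinomSeries {q : ℝ} (hq₀ : 0 < q) (hq₁ : q < 1) (x : ℝ) :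
    (1 - X) * qBinomSeries q x = (1 - C x * X) * rescale q (qBinomSeries q x) := by
  ext n
  cases n with
  | zero =>
    simp only [sub_mul, one_mul, mul_assoc, map_sub, coeff_zero_X_mul, coeff_C_mul, coeff_rescale,
      pow_zero, mul_zero]
  | succ n =>
    simp only [sub_mul, one_mul, mul_assoc, map_sub, coeff_succ_X_mul, coeff_C_mul, coeff_rescale,
      qBinomSeries, coeff_mk]
    linear_combination qCoef_succ_mul hq₀ hq₁ x n

/-- The functional equation determines each coefficient from the previous one because 1 - q^(n+1) ≠
0, and the geometric series satisfies it. -/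
theorem coeff_eq_one_of_one_sub_X_mul_eq {q : ℝ} (hq₀ : 0 < q) (hq₁ : q < 1) {P : PowerSeries ℝ}
    (h0 : coeff 0 P = 1) (h : (1 - X) * P = (1 - C q * X) * rescale q P) (n : ℕ) :
    coeff n P = 1 := by
  induction n with
  | zero => exact h0
  | succ n ih =>
    have := congrArg (coeff (n + 1)) h
    simp only [sub_mul, one_mul, mul_assoc, map_sub, coeff_succ_X_mul, coeff_C_mul,
      coeff_rescale, ih] at this
    have h1 : (1 - q ^ (n + 1)) * (coeff (n + 1) P - 1) = 0 := by linear_combination this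
    rcases mul_eq_zero.1 h1 with h2 | h2
    · exact absurd h2 (one_sub_pow_succ_pos hq₀ hq₁ n).ne'
    · linarith

/-- The case of the `q`-Vandermonde identity behind the semigroup property of the fractional
`q`-integrals of complementary orders. -/
theorem sum_antidiagonal_qCoef {q x y : ℝ} (hq₀ : 0 < q) (hq₁ : q < 1) (hxy : x * y = q) (m : ℕ) :
    ∑ ij ∈ Finset.HasAntidiagonal.antidiagonal m,
      y ^ ij.1 * qCoef q x ij.1 * qCoef q y ij.2 = 1 := by
  set F := rescale y (qBinomSeries q x)
  set G := qBinomSeries q y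
  have hF : (1 - C y * X) * F = (1 - C q * X) * rescale q F := by
    have := congrArg (rescale y) (one_sub_X_mul_qBinomSeries hq₀ hq₁ x)
    simp only [map_mul, map_sub, map_one, rescale_X] at this
    have hC : rescale y (C x) = C x := by
      ext n; rw [coeff_rescale, coeff_C]; split_ifs with h <;> simp [h]
    rw [hC] at this
    rw [this, ← mul_assoc (C x), ← map_mul, hxy, rescale_rescale, rescale_rescale, mul_comm q y]
  have hG : (1 - X) * G = (1 - C y * X) * rescale q G := one_sub_X_mul_qBinomSeries hq₀ hq₁ y
  have hne : (1 - C y * X : PowerSeries ℝ) ≠ 0 := by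
    intro h
    simpa using congrArg (coeff 0) h
  -- The factor 1 - yX occurs on opposite sides of `hF` and `hG`; cancelling it leaves the equation
  -- of the geometric series.
  have hP : (1 - X) * (F * G) = (1 - C q * X) * rescale q (F * G) := by
    apply mul_left_cancel₀ hne
    rw [map_mul]
    linear_combination (1 - X) * G * hF + (1 - C q * X) * rescale q F * hG
  have := coeff_eq_one_of_one_sub_X_mul_eq hq₀ hq₁ (P := F * G)
    (by simp [F, G, qBinomSeries, qCoef_zero, coeff_mul, coeff_rescale,
      -coeff_zero_eq_constantCoeff]) hP m
  rw [coeff_mul] at this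
  simpa [F, G, qBinomSeries, coeff_rescale] using this

end PowerSeries

/-- The coefficient is the term (0, m) of a sum of nonnegative terms equal to 1. -/
theorem qCoef_le_one {q x y : ℝ} (hq₀ : 0 < q) (hq₁ : q < 1) (hxy : x * y = q)
    (hx₁ : x ≤ 1) (hy : 0 ≤ y) (hy₁ : y ≤ 1) (m : ℕ) : qCoef q y m ≤ 1 := by
  have h := Finset.single_le_sum (s := Finset.HasAntidiagonal.antidiagonal m)
    (f := fun ij => y ^ ij.1 * qCoef q x ij.1 * qCoef q y ij.2)
    (fun ij _ => mul_nonneg (mul_nonneg (pow_nonneg hy _) (qCoef_nonneg hq₀ hq₁ hx₁ _))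
      (qCoef_nonneg hq₀ hq₁ hy₁ _)) (a := (0, m)) (by simp)
  rw [sum_antidiagonal_qCoef hq₀ hq₁ hxy] at h
  simpa [qCoef_zero] using h

/-! ### Infinite products and the kernels at grid points -/

theorem summable_norm_neg_mul_pow {q : ℝ} (hq₀ : 0 < q) (hq₁ : q < 1) (z : ℝ) :
    Summable fun i : ℕ => ‖-(z * q ^ i)‖ := by
  simp only [norm_neg, norm_mul, norm_pow]
  refine (summable_geometric_of_lt_one (norm_nonneg _) ?_).mul_left _
  rwa [Real.norm_of_nonneg hq₀.le]

theorem multipliable_one_sub_mul_pow {q : ℝ} (hq₀ : 0 < q) (hq₁ : q < 1) (z : ℝ) :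
    Multipliable fun i : ℕ => 1 - z * q ^ i := by
  simpa [sub_eq_add_neg] using
    multipliable_one_add_of_summable (summable_norm_neg_mul_pow hq₀ hq₁ z)

theorem qPochInf_ne_zero {q z : ℝ} (hq₀ : 0 < q) (hq₁ : q < 1) (hz : 0 ≤ z) (hz₁ : z < 1) :
    qPochInf q z ≠ 0 := by
  have := tprod_one_add_ne_zero_of_summable (f := fun i : ℕ => -(z * q ^ i)) (fun i => ?_)
    (summable_norm_neg_mul_pow hq₀ hq₁ z)
  · simpa [sub_eq_add_neg, qPochInf] using this
  · have : z * q ^ i < 1 := mul_lt_one_of_nonneg_of_lt_one_left hz hz₁ (pow_le_one₀ hq₀.le hq₁.le)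
    have : 0 < 1 + -(z * q ^ i) := by linarith
    exact this.ne'

theorem qPochInf_eq_prod_mul {q : ℝ} (hq₀ : 0 < q) (hq₁ : q < 1) (z : ℝ) (m : ℕ) :
    qPochInf q z = (∏ i ∈ Finset.range m, (1 - z * q ^ i)) * qPochInf q (z * q ^ m) := by
  have h : Multipliable fun i : ℕ => 1 - z * q ^ (i + m) := by
    have := multipliable_one_sub_mul_pow hq₀ hq₁ (z * q ^ m)
    simpa [mul_assoc, ← pow_add, add_comm] using this
  rw [qPochInf, ← Multipliable.prod_mul_tprod_nat_mul' (f := fun i : ℕ => 1 - z * q ^ i) h,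
    qPochInf]
  simp only [mul_assoc, ← pow_add, add_comm]

theorem qPochInf_eq_zero {q : ℝ} {z : ℝ} {j : ℕ} (h : z * q ^ j = 1) : qPochInf q z = 0 :=
  tprod_of_exists_eq_zero ⟨j, by rw [h, sub_self]⟩

theorem qGamma_ne_zero {q β : ℝ} (hq₀ : 0 < q) (hq₁ : q < 1) (hβ : 0 < β) : qGamma q β ≠ 0 :=
  mul_ne_zero (div_ne_zero (qPochInf_ne_zero hq₀ hq₁ hq₀.le hq₁)
    (qPochInf_ne_zero hq₀ hq₁ (by positivity) (Real.rpow_lt_one hq₀.le hq₁ hβ)))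
    (Real.rpow_pos_of_pos (by linarith) _).ne'

/-- Both infinite products are tails, of (q;q)_∞ and (q^β;q)_∞; splitting off the first m factors
turns their quotient into `qCoef`, up to the normalisation in `qGamma`. -/
theorem qPoch_pow_succ {q β : ℝ} (hq₀ : 0 < q) (hq₁ : q < 1) (hβ : 0 < β) (m : ℕ) :
    qPoch q (q ^ (m + 1)) (β - 1) = qGamma q β * (1 - q) ^ (β - 1) * qCoef q (q ^ β) m := by
  have hβ₁ : q ^ β < 1 := Real.rpow_lt_one hq₀.le hq₁ hβ
  have hβ₀ : 0 < q ^ β := by positivity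
  have e1 := qPochInf_eq_prod_mul hq₀ hq₁ q m
  have e2 := qPochInf_eq_prod_mul hq₀ hq₁ (q ^ β) m
  have n1 := qPochInf_ne_zero hq₀ hq₁ hq₀.le hq₁
  have n2 := qPochInf_ne_zero hq₀ hq₁ hβ₀.le hβ₁
  have n3 : qPochInf q (q ^ β * q ^ m) ≠ 0 := fun h => n2 (by rw [e2, h, mul_zero])
  have n4 : ∏ i ∈ Finset.range m, (1 - q * q ^ i) ≠ 0 := fun h => n1 (by rw [e1, h, zero_mul])
  have e3 : q ^ (m + 1) * q ^ (β - 1) = q ^ β * q ^ m := by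
    rw [Real.rpow_sub_one hq₀.ne', pow_succ]; field_simp
  have e4 : (1 - q) ^ (1 - β) * (1 - q) ^ (β - 1) = 1 := by
    rw [← Real.rpow_add (by linarith)]; simp
  have e5 : qCoef q (q ^ β) m = (∏ i ∈ Finset.range m, (1 - q ^ β * q ^ i)) /
      ∏ i ∈ Finset.range m, (1 - q * q ^ i) := by
    rw [qCoef, Finset.prod_div_distrib]
    simp only [pow_succ']
  rw [qPoch, e3, qGamma, e5, mul_assoc (_ / _), e4, mul_one, pow_succ', e2, e1]
  have n5 : ∏ i ∈ Finset.range m, (1 - q ^ β * q ^ i) ≠ 0 := fun h => n2 (by rw [e2, h, zero_mul])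
  field_simp

/-- The numerator has a vanishing factor. This cuts the right-sided integral down to a finite sum.
-/
theorem qPoch_inv_pow {q : ℝ} (hq₀ : 0 < q) (j : ℕ) (ν : ℝ) : qPoch q ((q ^ j)⁻¹) ν = 0 := by
  rw [qPoch, qPochInf_eq_zero (j := j) (inv_mul_cancel₀ (by positivity)), zero_div]

/-! ### Fractional integrals as weighted sums over the grid -/

section Operators

variable {E : Type*} [NormedAddCommGroup E] [NormedSpace ℝ E]

theorem jackson₀_zero (q : ℝ) (f : ℝ → E) : jackson₀ q 0 f = 0 := by simp [jackson₀]

theorem leftInt_zero (q β : ℝ) (f : ℝ → E) : leftInt q β f 0 = 0 := by simp [leftInt, jackson]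

theorem leftInt_eq_tsum {q β : ℝ} (hq₀ : 0 < q) (hq₁ : q < 1) (hβ : 0 < β) (f : ℝ → E) {x : ℝ}
    (hx : 0 < x) : leftInt q β f x =
      (((1 - q) * x) ^ β) • ∑' j : ℕ, (q ^ j * qCoef q (q ^ β) j) • f (x * q ^ j) := by
  have h : ∀ j : ℕ, q ^ j • qPoch q (q * (x * q ^ j) / x) (β - 1) • f (x * q ^ j) =
      (qGamma q β * (1 - q) ^ (β - 1)) • ((q ^ j * qCoef q (q ^ β) j) • f (x * q ^ j)) := by
    intro j
    have : q * (x * q ^ j) / x = q ^ (j + 1) := by rw [pow_succ]; field_simp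
    rw [this, qPoch_pow_succ hq₀ hq₁ hβ, smul_smul, smul_smul]
    congr 1; ring
  have hΓ := qGamma_ne_zero hq₀ hq₁ hβ
  have hq : 0 < 1 - q := by linarith
  rw [leftInt, jackson, jackson₀_zero, sub_zero, jackson₀, tsum_congr h, tsum_const_smul'',
    smul_smul, smul_smul, Real.mul_rpow hq.le hx.le]
  congr 1
  rw [Real.rpow_sub_one hx.ne', Real.rpow_sub_one hq.ne']
  field_simp

theorem rightInt_eq_sum {q a β : ℝ} (hq₀ : 0 < q) (hq₁ : q < 1) (ha : 0 < a) (hβ : 0 < β)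
    (f : ℝ → E) (n : ℕ) : rightInt q a β f (a * q ^ n) =
      (((1 - q) * a) ^ β) • ∑ k ∈ Finset.range (n + 1),
        (qCoef q (q ^ β) (n - k) * (q ^ β) ^ k) • f (a * q ^ k) := by
  set g : ℝ → E := fun t =>
    (t ^ (β - 1) * qPoch q (q * (a * q ^ n) / t) (β - 1)) • f t with hg
  have hz : ∀ k : ℕ, n + 1 ≤ k → g (a * q ^ k) = 0 := by
    intro k hk
    obtain ⟨j, rfl⟩ := Nat.exists_eq_add_of_le hk
    have : q * (a * q ^ n) / (a * q ^ (n + 1 + j)) = (q ^ j)⁻¹ := by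
      rw [pow_add, pow_succ]; field_simp
    simp only [hg, this, qPoch_inv_pow hq₀, mul_zero, zero_smul]
  -- Every node of the integral up to qx has index at least n + 1, where the kernel vanishes.
  have hlow : jackson₀ q (q * (a * q ^ n)) g = 0 := by
    have : ∀ j : ℕ, q ^ j • g (q * (a * q ^ n) * q ^ j) = 0 := by
      intro j
      have e : q * (a * q ^ n) * q ^ j = a * q ^ (n + 1 + j) := by
        rw [pow_add, pow_succ]; ring
      rw [e, hz _ (by omega), smul_zero]
    rw [jackson₀, tsum_congr this, tsum_zero, smul_zero]
  have hΓ := qGamma_ne_zero hq₀ hq₁ hβ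
  have hq : 0 < 1 - q := by linarith
  rw [rightInt, jackson, hlow, sub_zero, jackson₀, tsum_eq_sum (s := Finset.range (n + 1))
    (fun k hk => by
      have := hz k (by simpa using hk)
      simp only [hg] at this
      rw [this, smul_zero]), smul_smul, Finset.smul_sum,
    Finset.smul_sum]
  refine Finset.sum_congr rfl fun k hk => ?_
  obtain ⟨j, rfl⟩ := Nat.exists_eq_add_of_le (Nat.lt_succ_iff.1 (Finset.mem_range.1 hk))
  have e : q * (a * q ^ (k + j)) / (a * q ^ k) = q ^ (j + 1) := by
    rw [pow_add, pow_succ]; field_simp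
  have e2 : (a * q ^ k) ^ β = a ^ β * (q ^ β) ^ k := by
    rw [Real.mul_rpow ha.le (by positivity), Real.rpow_pow_comm hq₀.le]
  rw [e, qPoch_pow_succ hq₀ hq₁ hβ, smul_smul, smul_smul, smul_smul, Nat.add_sub_cancel_left,
    Real.rpow_sub_one (by positivity), Real.mul_rpow hq.le ha.le, e2, Real.rpow_sub_one hq.ne']
  congr 1
  field_simp

end Operators

/-! ### Bounds on the weights, suprema and summability -/

theorem rpow_mul_rpow_one_sub {q : ℝ} (hq₀ : 0 < q) (α : ℝ) : q ^ α * q ^ (1 - α) = q := by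
  rw [← Real.rpow_add hq₀]; simp

theorem qCoef_rpow_nonneg {q β : ℝ} (hq₀ : 0 < q) (hq₁ : q < 1) (hβ : 0 < β) (m : ℕ) :
    0 ≤ qCoef q (q ^ β) m :=
  qCoef_nonneg hq₀ hq₁ (Real.rpow_lt_one hq₀.le hq₁ hβ).le m

theorem qCoef_rpow_le_one {q β : ℝ} (hq₀ : 0 < q) (hq₁ : q < 1) (hβ₀ : 0 < β) (hβ₁ : β < 1)
    (m : ℕ) : qCoef q (q ^ β) m ≤ 1 :=
  qCoef_le_one hq₀ hq₁ (x := q ^ (1 - β)) (by rw [mul_comm, rpow_mul_rpow_one_sub hq₀])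
    (Real.rpow_lt_one hq₀.le hq₁ (by linarith)).le (by positivity)
    (Real.rpow_lt_one hq₀.le hq₁ hβ₀).le m

theorem tsum_sub_succ {E : Type*} [NormedAddCommGroup E] {v : ℕ → E} {l : E}
    (hv : Tendsto v atTop (𝓝 l)) (hs : Summable fun n => v n - v (n + 1)) :
    ∑' n, (v n - v (n + 1)) = v 0 - l := by
  refine tendsto_nhds_unique hs.hasSum.tendsto_sum_nat ?_
  simp only [Finset.sum_range_sub']
  exact tendsto_const_nhds.sub hv

theorem mul_pow_mem_gridStar {q a x : ℝ} (hx : x ∈ gridStar q a) (n : ℕ) :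
    x * q ^ n ∈ gridStar q a := by
  rcases hx with ⟨m, rfl⟩ | hx
  · exact Or.inl ⟨m + n, by ring⟩
  · right
    rw [Set.mem_singleton_iff.1 hx, zero_mul]
    rfl

theorem mem_gridStar (q a : ℝ) (n : ℕ) : a * q ^ n ∈ gridStar q a := Or.inl ⟨n, rfl⟩

/-- Boundedness is essential: the real `sSup` of an unbounded set is 0. -/
theorem norm_le_supNorm {E : Type*} [NormedAddCommGroup E] {q a : ℝ} {f : ℝ → E}
    (hf : ∃ C, ∀ x ∈ gridStar q a, ‖f x‖ ≤ C) {x : ℝ} (hx : x ∈ gridStar q a) :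
    ‖f x‖ ≤ supNorm q a f := by
  obtain ⟨C, hC⟩ := hf
  refine le_csSup ⟨C, ?_⟩ ⟨x, hx, 0, by simp⟩
  rintro _ ⟨z, hz, n, rfl⟩
  exact hC _ (mul_pow_mem_gridStar hz n)

theorem supNorm_nonneg {E : Type*} [NormedAddCommGroup E] (q a : ℝ) (f : ℝ → E) :
    0 ≤ supNorm q a f :=
  Real.sSup_nonneg (by rintro _ ⟨z, _, n, rfl⟩; exact norm_nonneg _)

theorem summable_mul_add {A d : ℕ → ℝ} (hA₀ : ∀ i, 0 ≤ A i) (hA : Summable A)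
    (hd₀ : ∀ i, 0 ≤ d i) (hd : Summable d) :
    Summable fun ij : ℕ × ℕ => A ij.1 * d (ij.1 + ij.2) := by
  have hs : ∀ i : ℕ, Summable fun j => d (i + j) := fun i => by
    simpa only [add_comm] using (summable_nat_add_iff i).2 hd
  have hle : ∀ i : ℕ, ∑' j, d (i + j) ≤ ∑' n, d n := fun i =>
    tsum_comp_le_tsum_of_inj hd hd₀ (add_right_injective i)
  refine (summable_prod_of_nonneg fun ij => mul_nonneg (hA₀ _) (hd₀ _)).2
    ⟨fun i => (hs i).mul_left (A i), ?_⟩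
  refine Summable.of_nonneg_of_le
    (fun i => tsum_nonneg fun j => mul_nonneg (hA₀ _) (hd₀ _)) (fun i => ?_)
    (hA.mul_right (∑' n, d n))
  have : ∑' j, A i * d (i + j) = A i * ∑' j, d (i + j) := tsum_mul_left
  exact this.trans_le (mul_le_mul_of_nonneg_left (hle i) (hA₀ i))

theorem summable_pow_mul {q : ℝ} (hq₀ : 0 < q) (hq₁ : q < 1) (M : ℝ) :
    Summable fun j : ℕ => q ^ j * M :=
  (summable_geometric_of_lt_one hq₀.le hq₁).mul_right M

/-! ### Estimates, inversion and composition of the fractional operators -/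

section Operators

variable {E : Type*} [NormedAddCommGroup E] [NormedSpace ℝ E]

theorem leftInt_congr {q β : ℝ} (hq₀ : 0 < q) (hq₁ : q < 1) (hβ : 0 < β) {f g : ℝ → E} {x : ℝ}
    (hx : 0 < x) (h : ∀ j : ℕ, f (x * q ^ j) = g (x * q ^ j)) :
    leftInt q β f x = leftInt q β g x := by
  rw [leftInt_eq_tsum hq₀ hq₁ hβ f hx, leftInt_eq_tsum hq₀ hq₁ hβ g hx]
  simp only [h]

theorem norm_qCoef_smul_le {q β : ℝ} (hq₀ : 0 < q) (hq₁ : q < 1) (hβ₀ : 0 < β) (hβ₁ : β < 1)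
    {v : E} {M : ℝ} (h : ‖v‖ ≤ M) (j : ℕ) :
    ‖(q ^ j * qCoef q (q ^ β) j) • v‖ ≤ q ^ j * M := by
  have h0 := qCoef_rpow_nonneg hq₀ hq₁ hβ₀ j
  have h1 := qCoef_rpow_le_one hq₀ hq₁ hβ₀ hβ₁ j
  rw [norm_smul, Real.norm_of_nonneg (by positivity), mul_assoc]
  refine mul_le_mul_of_nonneg_left ?_ (by positivity)
  calc qCoef q (q ^ β) j * ‖v‖ ≤ 1 * ‖v‖ := mul_le_mul_of_nonneg_right h1 (norm_nonneg _)
    _ ≤ M := by rwa [one_mul]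

theorem summable_leftInt [CompleteSpace E] {q β : ℝ} (hq₀ : 0 < q) (hq₁ : q < 1) (hβ₀ : 0 < β)
    (hβ₁ : β < 1) {v : ℕ → E} {M : ℝ} (h : ∀ j, ‖v j‖ ≤ M) :
    Summable fun j : ℕ => (q ^ j * qCoef q (q ^ β) j) • v j :=
  .of_norm_bounded (summable_pow_mul hq₀ hq₁ M)
    fun j => norm_qCoef_smul_le hq₀ hq₁ hβ₀ hβ₁ (h j) j

theorem leftInt_sub [CompleteSpace E] {q β : ℝ} (hq₀ : 0 < q) (hq₁ : q < 1) (hβ₀ : 0 < β)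
    (hβ₁ : β < 1) {f g : ℝ → E} {x M N : ℝ} (hx : 0 < x) (hf : ∀ j : ℕ, ‖f (x * q ^ j)‖ ≤ M)
    (hg : ∀ j : ℕ, ‖g (x * q ^ j)‖ ≤ N) :
    leftInt q β (fun t => f t - g t) x = leftInt q β f x - leftInt q β g x := by
  simp only [leftInt_eq_tsum hq₀ hq₁ hβ₀ _ hx, smul_sub]
  rw [← smul_sub, (summable_leftInt hq₀ hq₁ hβ₀ hβ₁ hf).tsum_sub
    (summable_leftInt hq₀ hq₁ hβ₀ hβ₁ hg)]

theorem leftInt_smul_const {q β : ℝ} (hq₀ : 0 < q) (hq₁ : q < 1) (hβ₀ : 0 < β)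
    (hβ₁ : β < 1) {f : ℝ → ℝ} {x M : ℝ} (hx : 0 < x) (hf : ∀ j : ℕ, ‖f (x * q ^ j)‖ ≤ M) (v : E) :
    leftInt q β (fun t => f t • v) x = leftInt q β f x • v := by
  simp only [leftInt_eq_tsum hq₀ hq₁ hβ₀ _ hx, smul_assoc]
  have h := (summable_leftInt hq₀ hq₁ hβ₀ hβ₁ hf).tsum_smul_const v
  simp only [smul_assoc] at h
  rw [h]

theorem norm_leftInt_le {q β : ℝ} (hq₀ : 0 < q) (hq₁ : q < 1) (hβ₀ : 0 < β)
    (hβ₁ : β < 1) {f : ℝ → E} {g : ℝ → ℝ} {x M : ℝ} (hx : 0 < x)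
    (hfg : ∀ j : ℕ, ‖f (x * q ^ j)‖ ≤ g (x * q ^ j)) (hg : ∀ j : ℕ, ‖g (x * q ^ j)‖ ≤ M) :
    ‖leftInt q β f x‖ ≤ leftInt q β g x := by
  have hs : 0 ≤ ((1 - q) * x) ^ β :=
    Real.rpow_nonneg (mul_nonneg (by linarith) hx.le) _
  rw [leftInt_eq_tsum hq₀ hq₁ hβ₀ f hx, leftInt_eq_tsum hq₀ hq₁ hβ₀ g hx, norm_smul,
    Real.norm_of_nonneg hs, smul_eq_mul]
  refine mul_le_mul_of_nonneg_left ?_ hs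
  refine tsum_of_norm_bounded (summable_leftInt hq₀ hq₁ hβ₀ hβ₁ hg).hasSum fun j => ?_
  have h0 := qCoef_rpow_nonneg hq₀ hq₁ hβ₀ j
  rw [norm_smul, Real.norm_of_nonneg (by positivity)]
  exact mul_le_mul_of_nonneg_left (hfg j) (by positivity)

theorem norm_leftInt_le_const {q β : ℝ} (hq₀ : 0 < q) (hq₁ : q < 1) (hβ₀ : 0 < β)
    (hβ₁ : β < 1) {f : ℝ → E} {x M : ℝ} (hx : 0 < x) (hf : ∀ j : ℕ, ‖f (x * q ^ j)‖ ≤ M) :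
    ‖leftInt q β f x‖ ≤ ((1 - q) * x) ^ β * ((1 - q)⁻¹ * M) := by
  have hs : 0 ≤ ((1 - q) * x) ^ β :=
    Real.rpow_nonneg (mul_nonneg (by linarith) hx.le) _
  rw [leftInt_eq_tsum hq₀ hq₁ hβ₀ f hx, norm_smul, Real.norm_of_nonneg hs]
  refine mul_le_mul_of_nonneg_left ?_ hs
  exact tsum_of_norm_bounded ((hasSum_geometric_of_lt_one hq₀.le hq₁).mul_right M)
    fun j => norm_qCoef_smul_le hq₀ hq₁ hβ₀ hβ₁ (hf j) j

/-- The Jackson weight q^j cancels the denominator of D_q, so plain increments of y remain and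
absolute continuity suffices for convergence. -/
theorem leftCaputo_eq_tsum {q α : ℝ} (hq₀ : 0 < q) (hq₁ : q < 1) (hα₁ : α < 1) (y : ℝ → E)
    {x : ℝ} (hx : 0 < x) : leftCaputo q α y x = (((1 - q) * x) ^ α)⁻¹ •
      ∑' j : ℕ, qCoef q (q ^ (1 - α)) j • (y (x * q ^ j) - y (x * q ^ (j + 1))) := by
  have hq : 0 < 1 - q := by linarith
  have h : ∀ j : ℕ, (q ^ j * qCoef q (q ^ (1 - α)) j) • qDeriv q y (x * q ^ j) =
      ((1 - q) * x)⁻¹ • (qCoef q (q ^ (1 - α)) j • (y (x * q ^ j) - y (x * q ^ (j + 1)))) := by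
    intro j
    have : q * (x * q ^ j) = x * q ^ (j + 1) := by ring
    rw [qDeriv, this, smul_smul, smul_smul]
    congr 1
    field_simp
  rw [leftCaputo, leftInt_eq_tsum hq₀ hq₁ (by linarith) _ hx, tsum_congr h, tsum_const_smul'',
    smul_smul, Real.rpow_sub (by positivity), Real.rpow_one]
  congr 1
  field_simp

/-- Fubini along antidiagonals; since B ≤ 1, the double family is dominated by A_i ‖d_(i+j)‖, which
is summable. -/
theorem tsum_smul_tsum_add_eq_tsum_antidiagonal [CompleteSpace E] {A B : ℕ → ℝ} {d : ℕ → E}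
    (hA₀ : ∀ i, 0 ≤ A i) (hA : Summable A) (hB₀ : ∀ j, 0 ≤ B j) (hB₁ : ∀ j, B j ≤ 1)
    (hd : Summable fun n => ‖d n‖) :
    ∑' i, A i • ∑' j, B j • d (i + j) =
      ∑' m, (∑ ij ∈ Finset.HasAntidiagonal.antidiagonal m, A ij.1 * B ij.2) • d m := by
  have hF : Summable fun ij : ℕ × ℕ => (A ij.1 * B ij.2) • d (ij.1 + ij.2) := by
    refine .of_norm_bounded (summable_mul_add hA₀ hA (fun _ => norm_nonneg _) hd) fun ij => ?_
    rw [norm_smul, Real.norm_of_nonneg (mul_nonneg (hA₀ _) (hB₀ _))]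
    exact mul_le_mul_of_nonneg_right (mul_le_of_le_one_right (hA₀ _) (hB₁ _)) (norm_nonneg _)
  have h1 := hF.tsum_prod
  have h2 := Finset.HasAntidiagonal.sigmaAntidiagonalEquivProd.tsum_eq
    (fun ij : ℕ × ℕ => (A ij.1 * B ij.2) • d (ij.1 + ij.2))
  have h3 := (Finset.HasAntidiagonal.sigmaAntidiagonalEquivProd.summable_iff.2 hF).tsum_sigma
  simp only [← smul_smul, tsum_const_smul''] at h1
  rw [← h1]
  simp only [smul_smul]
  rw [← h2]
  refine h3.trans (tsum_congr fun m => ?_)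
  rw [tsum_fintype, Finset.sum_smul, ← Finset.sum_coe_sort (Finset.HasAntidiagonal.antidiagonal m)]
  refine Finset.sum_congr rfl fun ij _ => ?_
  have := Finset.HasAntidiagonal.mem_antidiagonal.1 ij.2
  simp [this]

/-- The left sided fractional integral inverts the left sided Caputo derivative of the same
order. -/
theorem leftInt_leftCaputo [CompleteSpace E] {q α : ℝ} (hq₀ : 0 < q) (hq₁ : q < 1) (hα₀ : 0 < α)
    (hα₁ : α < 1) {y : ℝ → E} {x : ℝ} (hx : 0 < x)
    (hy : Tendsto (fun n : ℕ => y (x * q ^ n)) atTop (𝓝 (y 0)))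
    (hs : Summable fun n : ℕ => ‖y (x * q ^ n) - y (x * q ^ (n + 1))‖) :
    leftInt q α (leftCaputo q α y) x = y x - y 0 := by
  have hq : 0 < 1 - q := by linarith
  set d : ℕ → E := fun n => y (x * q ^ n) - y (x * q ^ (n + 1)) with hd
  have hY₁ : q ^ (1 - α) < 1 := Real.rpow_lt_one hq₀.le hq₁ (by linarith)
  have hα' : 0 < 1 - α := by linarith
  have hX : 0 < q ^ α := by positivity
  have h : ∀ j : ℕ, (q ^ j * qCoef q (q ^ α) j) • leftCaputo q α y (x * q ^ j) =
      (((1 - q) * x) ^ α)⁻¹ • ((q ^ (1 - α)) ^ j * qCoef q (q ^ α) j) •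
        ∑' i : ℕ, qCoef q (q ^ (1 - α)) i • d (j + i) := by
    intro j
    rw [leftCaputo_eq_tsum hq₀ hq₁ hα₁ y (by positivity), smul_smul, smul_smul]
    have e : ((1 - q) * (x * q ^ j)) ^ α = ((1 - q) * x) ^ α * (q ^ α) ^ j := by
      rw [← mul_assoc, Real.mul_rpow (by positivity) (by positivity), Real.rpow_pow_comm hq₀.le]
    -- The power of q^α is absorbed by the prefactor of the Caputo derivative at x q^j; the power of
    -- q^(1-α) left over is the one in the Vandermonde sum.
    have e2 : q ^ j = (q ^ α) ^ j * (q ^ (1 - α)) ^ j := by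
      rw [← mul_pow, rpow_mul_rpow_one_sub hq₀]
    congr 1
    · have : 0 < ((1 - q) * x) ^ α := by positivity
      rw [e, e2]
      field_simp
    · simp only [hd, mul_assoc, ← pow_add, add_assoc]
  rw [leftInt_eq_tsum hq₀ hq₁ hα₀ _ hx, tsum_congr h, tsum_const_smul'', smul_smul,
    mul_inv_cancel₀ (by positivity), one_smul, tsum_smul_tsum_add_eq_tsum_antidiagonal _ _ _ _ hs]
  -- All antidiagonal sums equal 1, so the series of increments telescopes to y(x) - y(0).
  · simp only [sum_antidiagonal_qCoef hq₀ hq₁ (rpow_mul_rpow_one_sub hq₀ α), one_smul]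
    simpa using tsum_sub_succ hy hs.of_norm
  · exact fun i => mul_nonneg (by positivity) (qCoef_rpow_nonneg hq₀ hq₁ hα₀ i)
  · refine Summable.of_nonneg_of_le
      (fun i => mul_nonneg (by positivity) (qCoef_rpow_nonneg hq₀ hq₁ hα₀ i))
      (fun i => mul_le_of_le_one_right (by positivity) (qCoef_rpow_le_one hq₀ hq₁ hα₀ hα₁ i))
      (summable_geometric_of_lt_one (by positivity) hY₁)
  · exact qCoef_rpow_nonneg hq₀ hq₁ hα'
  · exact qCoef_rpow_le_one hq₀ hq₁ hα' (by linarith)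

theorem sum_range_qCoef {q x y : ℝ} (hq₀ : 0 < q) (hq₁ : q < 1) (hxy : x * y = q) (n : ℕ) :
    ∑ k ∈ Finset.range (n + 1), qCoef q y (n - k) * y ^ k * qCoef q x k = 1 := by
  rw [← sum_antidiagonal_qCoef hq₀ hq₁ hxy n, Finset.Nat.sum_antidiagonal_eq_sum_range_succ_mk]
  exact Finset.sum_congr rfl fun k _ => by ring

/-- Right sided fractional `q`-integrals of complementary orders compose to the `q`-integral. -/
theorem sum_qCoef_smul_sum {q x y : ℝ} (hq₀ : 0 < q) (hq₁ : q < 1) (hxy : x * y = q) (s : ℕ → E)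
    (n : ℕ) : ∑ k ∈ Finset.range (n + 1), (qCoef q y (n - k) * y ^ k) •
      ∑ l ∈ Finset.range (k + 1), (qCoef q x (k - l) * x ^ l) • s l =
      ∑ l ∈ Finset.range (n + 1), q ^ l • s l := by
  simp only [Finset.smul_sum, smul_smul]
  rw [Finset.sum_comm' (t' := Finset.range (n + 1)) (s' := fun l => Finset.Ico l (n + 1))
    (by intro k l; simp only [Finset.mem_range, Finset.mem_Ico]; omega)]
  refine Finset.sum_congr rfl fun l hl => ?_
  rw [← Finset.sum_smul, Finset.sum_Ico_eq_sum_range]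
  congr 1
  have hl' : l ≤ n := Nat.lt_succ_iff.1 (Finset.mem_range.1 hl)
  -- As q^l = x^l y^l, this power factors out of the inner sum, which is then `sum_range_qCoef` at n
  -- - l.
  rw [show n + 1 - l = n - l + 1 by omega, ← mul_one (q ^ l),
    ← sum_range_qCoef hq₀ hq₁ hxy (n - l), Finset.mul_sum]
  refine Finset.sum_congr rfl fun i _ => ?_
  rw [Nat.add_sub_cancel_left, Nat.sub_sub, pow_add, ← hxy, mul_pow]
  ring

/-- The system is lower triangular with diagonal entries y^n ≠ 0, so right-sided fractional
integration is injective on the grid. -/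
theorem eq_of_sum_qCoef_smul_eq {q y : ℝ} (hy : y ≠ 0) {f g : ℕ → E}
    (h : ∀ n, ∑ k ∈ Finset.range (n + 1), (qCoef q y (n - k) * y ^ k) • f k =
      ∑ k ∈ Finset.range (n + 1), (qCoef q y (n - k) * y ^ k) • g k) (n : ℕ) : f n = g n := by
  induction n using Nat.strong_induction_on with
  | _ n ih =>
    have hn := h n
    rw [Finset.sum_range_succ, Finset.sum_range_succ,
      Finset.sum_congr rfl fun k hk => by rw [ih k (Finset.mem_range.1 hk)]] at hn
    have := add_left_cancel hn
    rw [Nat.sub_self, qCoef_zero, one_mul] at this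
    exact smul_right_injective E (pow_ne_zero n hy) this

theorem norm_rightInt_le {q a β : ℝ} (hq₀ : 0 < q) (hq₁ : q < 1) (ha : 0 < a) (hβ : 0 < β)
    {f : ℝ → E} {N : ℝ} (hf : ∀ k : ℕ, ‖f (a * q ^ k)‖ ≤ N) (n : ℕ) :
    ‖rightInt q a β f (a * q ^ n)‖ ≤ N * rightInt q a β (fun _ => (1 : ℝ)) (a * q ^ n) := by
  have hs : 0 ≤ ((1 - q) * a) ^ β := Real.rpow_nonneg (mul_nonneg (by linarith) ha.le) _
  rw [rightInt_eq_sum hq₀ hq₁ ha hβ, rightInt_eq_sum hq₀ hq₁ ha hβ, norm_smul,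
    Real.norm_of_nonneg hs, smul_eq_mul, mul_left_comm, Finset.mul_sum]
  refine mul_le_mul_of_nonneg_left (norm_sum_le_of_le _ fun k _ => ?_) hs
  have h0 := qCoef_rpow_nonneg hq₀ hq₁ hβ (n - k)
  rw [norm_smul, Real.norm_of_nonneg (by positivity), smul_eq_mul, mul_one, mul_comm]
  exact mul_le_mul_of_nonneg_right (hf k) (by positivity)

theorem rightInt_one_nonneg {q a β : ℝ} (hq₀ : 0 < q) (hq₁ : q < 1) (ha : 0 < a) (hβ : 0 < β)
    (n : ℕ) : 0 ≤ rightInt q a β (fun _ => (1 : ℝ)) (a * q ^ n) := by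
  have := norm_rightInt_le hq₀ hq₁ ha hβ (f := fun _ => (1 : ℝ)) (N := 1) (by simp) n
  rw [one_mul] at this
  exact (norm_nonneg _).trans this

theorem rightInt_one_le {q a β : ℝ} (hq₀ : 0 < q) (hq₁ : q < 1) (ha : 0 < a) (hβ₀ : 0 < β)
    (hβ₁ : β < 1) (n : ℕ) : rightInt q a β (fun _ => (1 : ℝ)) (a * q ^ n) ≤
      ((1 - q) * a) ^ β * (1 - q ^ β)⁻¹ := by
  have hs : 0 ≤ ((1 - q) * a) ^ β := Real.rpow_nonneg (mul_nonneg (by linarith) ha.le) _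
  have hX : q ^ β < 1 := Real.rpow_lt_one hq₀.le hq₁ hβ₀
  rw [rightInt_eq_sum hq₀ hq₁ ha hβ₀, smul_eq_mul]
  refine mul_le_mul_of_nonneg_left ?_ hs
  rw [← tsum_geometric_of_lt_one (by positivity) hX]
  refine (Finset.sum_le_sum fun k _ => ?_).trans
    ((summable_geometric_of_lt_one (by positivity) hX).sum_le_tsum (Finset.range (n + 1))
      fun k _ => by positivity)
  rw [smul_eq_mul, mul_one]
  exact mul_le_of_le_one_left (by positivity) (qCoef_rpow_le_one hq₀ hq₁ hβ₀ hβ₁ _)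

theorem exists_norm_leftInt_le {q a β : ℝ} (hq₀ : 0 < q) (hq₁ : q < 1) (ha : 0 < a) (hβ₀ : 0 < β)
    (hβ₁ : β < 1) {f : ℝ → E} {M : ℝ} (hf : ∀ k : ℕ, ‖f (a * q ^ k)‖ ≤ M) :
    ∃ C, ∀ x ∈ gridStar q a, ‖leftInt q β f x‖ ≤ C := by
  have hM : 0 ≤ M := (norm_nonneg _).trans (hf 0)
  have hq : 0 < 1 - q := by linarith
  refine ⟨((1 - q) * a) ^ β * ((1 - q)⁻¹ * M), ?_⟩
  rintro x (⟨n, rfl⟩ | hx)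
  · refine (norm_leftInt_le_const hq₀ hq₁ hβ₀ hβ₁ (by positivity)
      fun j => by rw [mul_assoc, ← pow_add]; exact hf _).trans ?_
    have : a * q ^ n ≤ a := mul_le_of_le_one_right ha.le (pow_le_one₀ hq₀.le hq₁.le)
    gcongr
  · rw [Set.mem_singleton_iff.1 hx, leftInt_zero, norm_zero]
    positivity

end Operators

/-! ### From the boundary value problem to an integral equation -/

theorem mInf_nonneg (q a : ℝ) (p : ℝ → ℝ) : 0 ≤ mInf q a p :=
  Real.sInf_nonneg (by rintro _ ⟨z, _, rfl⟩; exact abs_nonneg _)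

theorem mInf_le_abs (q a : ℝ) (p : ℝ → ℝ) (n : ℕ) : mInf q a p ≤ |p (a * q ^ n)| :=
  csInf_le ⟨0, by rintro _ ⟨z, _, rfl⟩; exact abs_nonneg _⟩ ⟨_, ⟨n, rfl⟩, rfl⟩

section Problem

variable {𝕜 : Type*} [RCLike 𝕜]

/-- At a q^k the equation ties u there to u at the preceding node, and the relations telescope. For
k = 0 the preceding node is a/q, which is how the outer value enters. -/
theorem SolvesWith.apply_eq_sub_sum {q a : ℝ} (hq₀ : 0 < q) (hq₁ : q < 1) (ha : 0 < a)
    {r w : ℝ → ℝ} {c₁ c₂ d₁ d₂ : ℝ} {lam : 𝕜} {u y : ℝ → 𝕜}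
    (h : SolvesWith q a r w c₁ c₂ d₁ d₂ lam u y) (n : ℕ) :
    u (a * q ^ n) = u (a / q) - ((1 - q) * a) • ∑ k ∈ Finset.range (n + 1),
      q ^ k • (((r (a * q ^ k) : 𝕜) - lam * (w (a * q ^ k) : 𝕜)) * y (a * q ^ k)) := by
  have step : ∀ k : ℕ, u (a * q ^ k) = u (a * q ^ k / q) - ((1 - q) * a) •
      q ^ k • (((r (a * q ^ k) : 𝕜) - lam * (w (a * q ^ k) : 𝕜)) * y (a * q ^ k)) := by
    intro k
    obtain ⟨d, hd, he⟩ := h.2.1 _ (mem_gridStar q a k)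
    have hx : 0 < a * q ^ k := by positivity
    have hd' := hd.1 hx.ne'
    have hne : a * q ^ k - a * q ^ k / q ≠ 0 := by
      have : a * q ^ k - a * q ^ k / q = a * q ^ k * (q - 1) / q := by field_simp
      rw [this]
      exact div_ne_zero (mul_ne_zero hx.ne' (by linarith)) hq₀.ne'
    have e1 : (a * q ^ k - a * q ^ k / q) • d = u (a * q ^ k) - u (a * q ^ k / q) := by
      rw [hd', smul_smul, mul_inv_cancel₀ hne, one_smul]
    have e2 : d = q • (((r (a * q ^ k) : 𝕜) - lam * (w (a * q ^ k) : 𝕜)) * y (a * q ^ k)) := by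
      have hqk : (q : 𝕜) ≠ 0 := by exact_mod_cast hq₀.ne'
      simp only [RCLike.real_smul_eq_coe_mul] at he ⊢
      push_cast at he
      field_simp at he
      linear_combination -he
    rw [e2, smul_smul] at e1
    have e3 : (a * q ^ k - a * q ^ k / q) * q = -((1 - q) * a * q ^ k) := by
      field_simp; ring
    rw [e3, neg_smul] at e1
    rw [smul_smul]
    linear_combination -e1
  induction n with
  | zero => simpa using step 0
  | succ n ih =>
    have e : a * q ^ (n + 1) / q = a * q ^ n := by rw [pow_succ]; field_simp
    rw [step (n + 1), e, ih, Finset.sum_range_succ _ (n + 1), smul_add, sub_sub]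

/-- The equation at x = 0 supplies a finite limit of difference quotients; multiplying by a q^n → 0
gives continuity of u along the grid. -/
theorem SolvesWith.tendsto {q a : ℝ} (hq₀ : 0 < q) (hq₁ : q < 1) (ha : 0 < a)
    {r w : ℝ → ℝ} {c₁ c₂ d₁ d₂ : ℝ} {lam : 𝕜} {u y : ℝ → 𝕜}
    (h : SolvesWith q a r w c₁ c₂ d₁ d₂ lam u y) :
    Tendsto (fun n : ℕ => u (a * q ^ n)) atTop (𝓝 (u 0)) := by
  obtain ⟨d, hd, -⟩ := h.2.1 0 (Or.inr rfl)
  have h0 : Tendsto (fun n : ℕ => a * q ^ n) atTop (𝓝 0) := by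
    simpa using (tendsto_pow_atTop_nhds_zero_of_lt_one hq₀.le hq₁).const_mul a
  have h1 := (h0.smul (hd.2 rfl)).add_const (u 0)
  simp only [zero_smul, zero_add] at h1
  refine h1.congr fun n => ?_
  rw [smul_smul, mul_inv_cancel₀ (by positivity), one_smul, sub_add_cancel]

theorem QAbsCont.summable {q a : ℝ} {y : ℝ → 𝕜} (h : QAbsCont q a y) {x : ℝ}
    (hx : x ∈ gridStar q a) : Summable fun n : ℕ => ‖y (x * q ^ n) - y (x * q ^ (n + 1))‖ := by
  obtain ⟨K, hK⟩ := h.2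
  exact summable_of_sum_range_le (fun _ => norm_nonneg _) (hK x hx)

/-- The solution of the first order problem for the flux, in terms of its value at `a / q`. -/
theorem SolvesWith.mul_leftCaputo_eq {q a α : ℝ} (hq₀ : 0 < q) (hq₁ : q < 1) (ha : 0 < a)
    (hα₀ : 0 < α) (hα₁ : α < 1) {p r w : ℝ → ℝ} {c₁ c₂ d₁ d₂ : ℝ} {lam : 𝕜} {u y : ℝ → 𝕜}
    (h : SolvesWith q a r w c₁ c₂ d₁ d₂ lam u y)
    (hu : Set.EqOn u (flux q a α p y) (gridStar q a)) (n : ℕ) :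
    p (a * q ^ n) • leftCaputo q α y (a * q ^ n) =
      (((1 - q) * a) ^ (α - 1) * qCoef q (q ^ α) n) • u (a / q) -
        rightInt q a α (fun x => ((r x : 𝕜) - lam * (w x : 𝕜)) * y x) (a * q ^ n) := by
  set f : ℝ → 𝕜 := fun x => ((r x : 𝕜) - lam * (w x : 𝕜)) * y x with hf
  have hb : 0 < (1 - q) * a := mul_pos (by linarith) ha
  have hxy := rpow_mul_rpow_one_sub hq₀ α
  have hb' : 0 < ((1 - q) * a) ^ (1 - α) := by positivity
  -- It suffices to compare the right integrals of order 1 - α of the two sides: the kernel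
  -- multiplying U integrates to 1, and the other term becomes the q-integral in the summed
  -- equation.
  refine eq_of_sum_qCoef_smul_eq (q := q) (y := q ^ (1 - α)) (by positivity)
    (f := fun n => p (a * q ^ n) • leftCaputo q α y (a * q ^ n))
    (g := fun n => (((1 - q) * a) ^ (α - 1) * qCoef q (q ^ α) n) • u (a / q) -
        rightInt q a α f (a * q ^ n)) (fun n => ?_) n
  apply smul_right_injective 𝕜 hb'.ne'
  have h1 := hu (mem_gridStar q a n)
  rw [flux, rightInt_eq_sum hq₀ hq₁ ha (by linarith), h.apply_eq_sub_sum hq₀ hq₁ ha] at h1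
  refine h1.symm.trans ?_
  simp only [smul_sub, Finset.sum_sub_distrib, rightInt_eq_sum hq₀ hq₁ ha hα₀]
  congr 1
  · simp only [smul_smul]
    rw [← Finset.sum_smul, smul_smul]
    have e : ∑ k ∈ Finset.range (n + 1), qCoef q (q ^ (1 - α)) (n - k) * (q ^ (1 - α)) ^ k *
        (((1 - q) * a) ^ (α - 1) * qCoef q (q ^ α) k) = ((1 - q) * a) ^ (α - 1) := by
      refine Eq.trans ?_ ((congrArg (((1 - q) * a) ^ (α - 1) * ·)
        (sum_range_qCoef hq₀ hq₁ hxy n)).trans (mul_one _))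
      rw [Finset.mul_sum]
      exact Finset.sum_congr rfl fun k _ => by ring
    rw [e, ← Real.rpow_add hb]
    simp
  · rw [← sum_qCoef_smul_sum hq₀ hq₁ hxy]
    simp only [smul_comm _ (((1 - q) * a) ^ α)]
    rw [← Finset.smul_sum, smul_smul, mul_comm (((1 - q) * a) ^ (1 - α)),
      rpow_mul_rpow_one_sub hb]

theorem psi_integrand_eq {q a α : ℝ} (hq₀ : 0 < q) (hq₁ : q < 1) (ha : 0 < a)
    (hα₀ : 0 < α) (p : ℝ → ℝ) (n : ℕ) :
    a ^ (α - 1) * qPoch q (q * (a * q ^ n) / a) (α - 1) / (qGamma q α * p (a * q ^ n)) =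
      (p (a * q ^ n))⁻¹ * (((1 - q) * a) ^ (α - 1) * qCoef q (q ^ α) n) := by
  have e : q * (a * q ^ n) / a = q ^ (n + 1) := by rw [pow_succ]; field_simp
  have := qGamma_ne_zero hq₀ hq₁ hα₀
  rw [e, qPoch_pow_succ hq₀ hq₁ hα₀, Real.mul_rpow (by linarith) ha.le]
  field_simp

theorem norm_psi_integrand_le {q a α : ℝ} (hq₀ : 0 < q) (hq₁ : q < 1) (ha : 0 < a)
    (hα₀ : 0 < α) (hα₁ : α < 1) {p : ℝ → ℝ} (hm : 0 < mInf q a p) (n : ℕ) :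
    ‖a ^ (α - 1) * qPoch q (q * (a * q ^ n) / a) (α - 1) / (qGamma q α * p (a * q ^ n))‖ ≤
      (mInf q a p)⁻¹ * ((1 - q) * a) ^ (α - 1) := by
  have hb : 0 < (1 - q) * a := mul_pos (by linarith) ha
  have h0 := qCoef_rpow_nonneg hq₀ hq₁ hα₀ n
  rw [psi_integrand_eq hq₀ hq₁ ha hα₀, norm_mul, norm_inv, Real.norm_eq_abs,
    Real.norm_of_nonneg (by positivity)]
  gcongr
  · exact mInf_le_abs q a p n
  · exact mul_le_of_le_one_right (by positivity) (qCoef_rpow_le_one hq₀ hq₁ hα₀ hα₁ n)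

theorem exists_norm_psi_le {q a α : ℝ} (hq₀ : 0 < q) (hq₁ : q < 1) (ha : 0 < a)
    (hα₀ : 0 < α) (hα₁ : α < 1) {p : ℝ → ℝ} (hm : 0 < mInf q a p) :
    ∃ C, ∀ x ∈ gridStar q a, ‖psi q a α p x‖ ≤ C :=
  exists_norm_leftInt_le hq₀ hq₁ ha hα₀ hα₁ (norm_psi_integrand_le hq₀ hq₁ ha hα₀ hα₁ hm)

theorem norm_rightInt_one_le {q a α : ℝ} (hq₀ : 0 < q) (hq₁ : q < 1) (ha : 0 < a)
    (hα₀ : 0 < α) (hα₁ : α < 1) (n : ℕ) : ‖rightInt q a α (fun _ => (1 : ℝ)) (a * q ^ n)‖ ≤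
      ((1 - q) * a) ^ α * (1 - q ^ α)⁻¹ := by
  rw [Real.norm_of_nonneg (rightInt_one_nonneg hq₀ hq₁ ha hα₀ n)]
  exact rightInt_one_le hq₀ hq₁ ha hα₀ hα₁ n

theorem exists_norm_phi_le {q a α : ℝ} (hq₀ : 0 < q) (hq₁ : q < 1) (ha : 0 < a)
    (hα₀ : 0 < α) (hα₁ : α < 1) : ∃ C, ∀ x ∈ gridStar q a, ‖phi q a α x‖ ≤ C :=
  exists_norm_leftInt_le hq₀ hq₁ ha hα₀ hα₁ (norm_rightInt_one_le hq₀ hq₁ ha hα₀ hα₁)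

theorem norm_inv_smul_rightInt_le {q a α : ℝ} (hq₀ : 0 < q) (hq₁ : q < 1) (ha : 0 < a)
    (hα₀ : 0 < α) {p : ℝ → ℝ} (hm : 0 < mInf q a p) {f : ℝ → 𝕜} {N : ℝ}
    (hf : ∀ k : ℕ, ‖f (a * q ^ k)‖ ≤ N) (n : ℕ) :
    ‖(p (a * q ^ n))⁻¹ • rightInt q a α f (a * q ^ n)‖ ≤
      (N / mInf q a p) * rightInt q a α (fun _ => (1 : ℝ)) (a * q ^ n) := by
  have hN : 0 ≤ N := (norm_nonneg _).trans (hf 0)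
  have h1 := rightInt_one_nonneg hq₀ hq₁ ha hα₀ n
  rw [norm_smul, norm_inv, Real.norm_eq_abs, div_mul_eq_mul_div, div_eq_inv_mul]
  gcongr
  · exact mInf_le_abs q a p n
  · exact norm_rightInt_le hq₀ hq₁ ha hα₀ hf n

theorem leftInt_const_mul {q β : ℝ} (c : ℝ) (hq₀ : 0 < q) (hq₁ : q < 1) (hβ : 0 < β) (f : ℝ → ℝ)
    {x : ℝ} (hx : 0 < x) : leftInt q β (fun t => c * f t) x = c * leftInt q β f x := by
  simp only [leftInt_eq_tsum hq₀ hq₁ hβ _ hx, smul_eq_mul, mul_left_comm _ c, tsum_mul_left]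

theorem norm_leftInt_inv_smul_rightInt_le {q a α : ℝ} (hq₀ : 0 < q) (hq₁ : q < 1) (ha : 0 < a)
    (hα₀ : 0 < α) (hα₁ : α < 1) {p : ℝ → ℝ} (hm : 0 < mInf q a p) {f : ℝ → 𝕜} {N : ℝ}
    (hf : ∀ k : ℕ, ‖f (a * q ^ k)‖ ≤ N) (n : ℕ) :
    ‖leftInt q α (fun t => (p t)⁻¹ • rightInt q a α f t) (a * q ^ n)‖ ≤
      (N / mInf q a p) * phi q a α (a * q ^ n) := by
  have hN : 0 ≤ N := (norm_nonneg _).trans (hf 0)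
  have hx : 0 < a * q ^ n := by positivity
  rw [phi, ← leftInt_const_mul _ hq₀ hq₁ hα₀ _ hx]
  refine norm_leftInt_le hq₀ hq₁ hα₀ hα₁ hx
    (M := (N / mInf q a p) * (((1 - q) * a) ^ α * (1 - q ^ α)⁻¹)) (fun j => ?_) fun j => ?_
  · rw [mul_assoc, ← pow_add]
    exact norm_inv_smul_rightInt_le hq₀ hq₁ ha hα₀ hm hf _
  · rw [mul_assoc, ← pow_add, norm_mul, Real.norm_of_nonneg (by positivity)]
    exact mul_le_mul_of_nonneg_left (norm_rightInt_one_le hq₀ hq₁ ha hα₀ hα₁ _) (by positivity)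

/-- The integral equation satisfied by a solution, before the boundary conditions are used. -/
theorem SolvesWith.apply_eq {q a α : ℝ} (hq₀ : 0 < q) (hq₁ : q < 1) (ha : 0 < a)
    (hα₀ : 0 < α) (hα₁ : α < 1) {p r w : ℝ → ℝ} {c₁ c₂ d₁ d₂ : ℝ} {lam : 𝕜} {u y : ℝ → 𝕜}
    (hp : ∀ x ∈ gridStar q a, p x ≠ 0) (hm : 0 < mInf q a p)
    (h : SolvesWith q a r w c₁ c₂ d₁ d₂ lam u y)
    (hu : Set.EqOn u (flux q a α p y) (gridStar q a)) {N : ℝ}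
    (hN : ∀ k : ℕ, ‖((r (a * q ^ k) : 𝕜) - lam * (w (a * q ^ k) : 𝕜)) * y (a * q ^ k)‖ ≤ N)
    (n : ℕ) :
    y (a * q ^ n) = y 0 + psi q a α p (a * q ^ n) • u (a / q) -
      leftInt q α (fun t => (p t)⁻¹ •
        rightInt q a α (fun x => ((r x : 𝕜) - lam * (w x : 𝕜)) * y x) t) (a * q ^ n) := by
  have hx : 0 < a * q ^ n := by positivity
  have hmem := mem_gridStar q a n
  have hN₀ : 0 ≤ N := (norm_nonneg _).trans (hN 0)
  have h1 := leftInt_leftCaputo hq₀ hq₁ hα₀ hα₁ hx (h.1.1 _ hmem) (h.1.summable hmem)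
  have hψ : ∀ j : ℕ, ‖a ^ (α - 1) * qPoch q (q * (a * q ^ n * q ^ j) / a) (α - 1) /
      (qGamma q α * p (a * q ^ n * q ^ j))‖ ≤ (mInf q a p)⁻¹ * ((1 - q) * a) ^ (α - 1) := by
    intro j
    rw [mul_assoc a, ← pow_add]
    exact norm_psi_integrand_le hq₀ hq₁ ha hα₀ hα₁ hm _
  have h2 : leftInt q α (leftCaputo q α y) (a * q ^ n) = leftInt q α (fun t =>
      (a ^ (α - 1) * qPoch q (q * t / a) (α - 1) / (qGamma q α * p t)) • u (a / q) -
      (p t)⁻¹ • rightInt q a α (fun x => ((r x : 𝕜) - lam * (w x : 𝕜)) * y x) t) (a * q ^ n) := by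
    refine leftInt_congr hq₀ hq₁ hα₀ hx fun j => ?_
    rw [mul_assoc a, ← pow_add, psi_integrand_eq hq₀ hq₁ ha hα₀, ← smul_smul, ← smul_sub,
      ← h.mul_leftCaputo_eq hq₀ hq₁ ha hα₀ hα₁ hu, smul_smul,
      inv_mul_cancel₀ (hp _ (mem_gridStar q a _)), one_smul]
  rw [leftInt_sub hq₀ hq₁ hα₀ hα₁ hx
    (M := (mInf q a p)⁻¹ * ((1 - q) * a) ^ (α - 1) * ‖u (a / q)‖)
    (N := (N / mInf q a p) * (((1 - q) * a) ^ α * (1 - q ^ α)⁻¹)),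
    leftInt_smul_const hq₀ hq₁ hα₀ hα₁ hx hψ, h1, ← psi] at h2
  · linear_combination h2
  · intro j
    rw [norm_smul]
    exact mul_le_mul_of_nonneg_right (hψ j) (norm_nonneg _)
  · intro j
    rw [mul_assoc a, ← pow_add]
    exact (norm_inv_smul_rightInt_le hq₀ hq₁ ha hα₀ hm hN _).trans
      (mul_le_mul_of_nonneg_left (rightInt_one_le hq₀ hq₁ ha hα₀ hα₁ _) (by positivity))

/-- Let n → ∞ in the summed equation and use (1 - q) ∑ q^k = 1. -/
theorem SolvesWith.norm_sub_le {q a : ℝ} (hq₀ : 0 < q) (hq₁ : q < 1) (ha : 0 < a)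
    {r w : ℝ → ℝ} {c₁ c₂ d₁ d₂ : ℝ} {lam : 𝕜} {u y : ℝ → 𝕜}
    (h : SolvesWith q a r w c₁ c₂ d₁ d₂ lam u y) {N : ℝ}
    (hN : ∀ k : ℕ, ‖((r (a * q ^ k) : 𝕜) - lam * (w (a * q ^ k) : 𝕜)) * y (a * q ^ k)‖ ≤ N) :
    ‖u (a / q) - u 0‖ ≤ a * N := by
  have hq : 0 < 1 - q := by linarith
  have hN₀ : 0 ≤ N := (norm_nonneg _).trans (hN 0)
  refine le_of_tendsto ((tendsto_const_nhds.sub (h.tendsto hq₀ hq₁ ha)).norm)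
    (Eventually.of_forall fun n => ?_)
  rw [h.apply_eq_sub_sum hq₀ hq₁ ha, sub_sub_cancel, norm_smul, Real.norm_of_nonneg (by positivity)]
  have h1 : ‖∑ k ∈ Finset.range (n + 1),
      q ^ k • (((r (a * q ^ k) : 𝕜) - lam * (w (a * q ^ k) : 𝕜)) * y (a * q ^ k))‖ ≤
      (1 - q)⁻¹ * N := by
    refine (norm_sum_le_of_le (n := fun k => q ^ k * N) _ fun k _ => ?_).trans ?_
    · rw [norm_smul, Real.norm_of_nonneg (by positivity)]
      exact mul_le_mul_of_nonneg_left (hN k) (by positivity)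
    · rw [← Finset.sum_mul, ← tsum_geometric_of_lt_one hq₀.le hq₁]
      exact mul_le_mul_of_nonneg_right ((summable_geometric_of_lt_one hq₀.le hq₁).sum_le_tsum _
        fun k _ => by positivity) hN₀
  calc (1 - q) * a * _ ≤ (1 - q) * a * ((1 - q)⁻¹ * N) :=
        mul_le_mul_of_nonneg_left h1 (by positivity)
    _ = a * N := by field_simp

/-- The integral equation for the regular problem: the unknown boundary values are eliminated by
means of the boundary conditions. -/
theorem SolvesWith.apply_eq_coef {q a α : ℝ} (hq₀ : 0 < q) (hq₁ : q < 1) (ha : 0 < a)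
    (hα₀ : 0 < α) (hα₁ : α < 1) {p r w : ℝ → ℝ} {c₁ c₂ d₁ d₂ : ℝ} {lam : 𝕜} {u y : ℝ → 𝕜}
    (hp : ∀ x ∈ gridStar q a, p x ≠ 0) (hm : 0 < mInf q a p) (hΔ : bdet q a α p c₁ c₂ d₁ d₂ ≠ 0)
    (h : SolvesWith q a r w c₁ c₂ d₁ d₂ lam u y)
    (hu : Set.EqOn u (flux q a α p y) (gridStar q a)) {N : ℝ}
    (hN : ∀ k : ℕ, ‖((r (a * q ^ k) : 𝕜) - lam * (w (a * q ^ k) : 𝕜)) * y (a * q ^ k)‖ ≤ N)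
    (n : ℕ) :
    y (a * q ^ n) = coefA q a α p c₁ c₂ d₁ d₂ (a * q ^ n) • (u (a / q) - u 0) +
      coefB q a α p c₁ c₂ d₁ d₂ (a * q ^ n) • leftInt q α (fun t => (p t)⁻¹ •
        rightInt q a α (fun x => ((r x : 𝕜) - lam * (w x : 𝕜)) * y x) t) a -
      leftInt q α (fun t => (p t)⁻¹ •
        rightInt q a α (fun x => ((r x : 𝕜) - lam * (w x : 𝕜)) * y x) t) (a * q ^ n) := by
  have hn := h.apply_eq hq₀ hq₁ ha hα₀ hα₁ hp hm hu hN n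
  have h0 := h.apply_eq hq₀ hq₁ ha hα₀ hα₁ hp hm hu hN 0
  rw [pow_zero, mul_one] at h0
  obtain ⟨-, -, hb0, hba⟩ := h
  set T := leftInt q α (fun t => (p t)⁻¹ •
        rightInt q a α (fun x => ((r x : 𝕜) - lam * (w x : 𝕜)) * y x) t)
  rw [hn]
  rw [h0] at hba
  have hΔ' : (bdet q a α p c₁ c₂ d₁ d₂ : 𝕜) ≠ 0 := by exact_mod_cast hΔ
  have hD : (bdet q a α p c₁ c₂ d₁ d₂ : 𝕜) =
      c₁ * d₂ - c₂ * d₁ + c₁ * d₁ * (psi q a α p a : 𝕜) := by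
    simp only [bdet]; push_cast; ring
  have hA : (coefA q a α p c₁ c₂ d₁ d₂ (a * q ^ n) : 𝕜) = c₂ / (bdet q a α p c₁ c₂ d₁ d₂ : 𝕜) *
      (d₂ + d₁ * ((psi q a α p a : 𝕜) - (psi q a α p (a * q ^ n) : 𝕜))) := by
    simp only [coefA]; push_cast; ring
  have hB : (coefB q a α p c₁ c₂ d₁ d₂ (a * q ^ n) : 𝕜) = d₁ / (bdet q a α p c₁ c₂ d₁ d₂ : 𝕜) *
      (c₁ * (psi q a α p (a * q ^ n) : 𝕜) - c₂) := by
    simp only [coefB]; push_cast; ring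
  simp only [RCLike.real_smul_eq_coe_mul] at hb0 hba ⊢
  rw [hA, hB]
  generalize (bdet q a α p c₁ c₂ d₁ d₂ : 𝕜) = D at hΔ' hD ⊢
  generalize (psi q a α p a : 𝕜) = Pa at hD hba ⊢
  generalize (psi q a α p (a * q ^ n) : 𝕜) = Pn
  generalize T a = Ta at hba ⊢
  generalize T (a * q ^ n) = Tn
  field_simp
  rw [hD]
  -- Cramer's rule: these multipliers of the two boundary conditions produce Δ(y(0) + ψ(x)U).
  linear_combination (d₂ + d₁ * Pa - d₁ * Pn) * hb0 + (c₁ * Pn - c₂) * hba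

/-! ### The contraction estimate -/

theorem exists_norm_coefA_le {q a α : ℝ} (hq₀ : 0 < q) (hq₁ : q < 1) (ha : 0 < a)
    (hα₀ : 0 < α) (hα₁ : α < 1) {p : ℝ → ℝ} (hm : 0 < mInf q a p) (c₁ c₂ d₁ d₂ : ℝ) :
    ∃ C, ∀ x ∈ gridStar q a, ‖coefA q a α p c₁ c₂ d₁ d₂ x‖ ≤ C := by
  obtain ⟨C, hC⟩ := exists_norm_psi_le hq₀ hq₁ ha hα₀ hα₁ hm
  refine ⟨‖c₂ / bdet q a α p c₁ c₂ d₁ d₂‖ * (‖d₂‖ + ‖d₁‖ * (‖psi q a α p a‖ + C)), fun x hx => ?_⟩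
  rw [coefA, norm_mul]
  refine mul_le_mul_of_nonneg_left ((norm_add_le _ _).trans (add_le_add_right ?_ _)) (norm_nonneg _)
  rw [norm_mul]
  exact mul_le_mul_of_nonneg_left ((norm_sub_le _ _).trans (add_le_add_right (hC x hx) _))
    (norm_nonneg _)

theorem exists_norm_coefB_le {q a α : ℝ} (hq₀ : 0 < q) (hq₁ : q < 1) (ha : 0 < a)
    (hα₀ : 0 < α) (hα₁ : α < 1) {p : ℝ → ℝ} (hm : 0 < mInf q a p) (c₁ c₂ d₁ d₂ : ℝ) :
    ∃ C, ∀ x ∈ gridStar q a, ‖coefB q a α p c₁ c₂ d₁ d₂ x‖ ≤ C := by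
  obtain ⟨C, hC⟩ := exists_norm_psi_le hq₀ hq₁ ha hα₀ hα₁ hm
  refine ⟨‖d₁ / bdet q a α p c₁ c₂ d₁ d₂‖ * (‖c₁‖ * C + ‖c₂‖), fun x hx => ?_⟩
  rw [coefB, norm_mul]
  refine mul_le_mul_of_nonneg_left ((norm_sub_le _ _).trans (add_le_add_left ?_ _)) (norm_nonneg _)
  rw [norm_mul]
  exact mul_le_mul_of_nonneg_left (hC x hx) (norm_nonneg _)

/-- A solution bounded by `S` on the grid is bounded by `κ S`, where `κ` is the contraction constant
of the integral operator. -/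
theorem SolvesWith.norm_apply_le {q a α : ℝ} (hq₀ : 0 < q) (hq₁ : q < 1) (ha : 0 < a)
    (hα₀ : 0 < α) (hα₁ : α < 1) {p r w : ℝ → ℝ} {c₁ c₂ d₁ d₂ : ℝ} {lam : 𝕜} {u y : ℝ → 𝕜}
    (hp : ∀ x ∈ gridStar q a, p x ≠ 0) (hm : 0 < mInf q a p) (hΔ : bdet q a α p c₁ c₂ d₁ d₂ ≠ 0)
    (hbdd : ∃ C : ℝ, ∀ x ∈ gridStar q a, ‖(r x : 𝕜) - lam * (w x : 𝕜)‖ ≤ C)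
    (h : SolvesWith q a r w c₁ c₂ d₁ d₂ lam u y)
    (hu : Set.EqOn u (flux q a α p y) (gridStar q a)) {S : ℝ}
    (hS : ∀ k : ℕ, ‖y (a * q ^ k)‖ ≤ S) (n : ℕ) :
    ‖y (a * q ^ n)‖ ≤ supNorm q a (fun x => (r x : 𝕜) - lam * (w x : 𝕜)) *
      ((supNorm q a (phi q a α) + supNorm q a (coefB q a α p c₁ c₂ d₁ d₂) * phi q a α a +
        supNorm q a (coefA q a α p c₁ c₂ d₁ d₂) * a * mInf q a p) / mInf q a p) * S := by
  set H := supNorm q a (fun x => (r x : 𝕜) - lam * (w x : 𝕜))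
  have hH : 0 ≤ H := supNorm_nonneg q a _
  have hN : ∀ k : ℕ,
      ‖((r (a * q ^ k) : 𝕜) - lam * (w (a * q ^ k) : 𝕜)) * y (a * q ^ k)‖ ≤ H * S := by
    intro k
    rw [norm_mul]
    exact mul_le_mul (norm_le_supNorm hbdd (mem_gridStar q a k)) (hS k) (norm_nonneg _) hH
  have hS₀ : 0 ≤ S := (norm_nonneg _).trans (hS 0)
  have hmem := mem_gridStar q a n
  have hT := norm_leftInt_inv_smul_rightInt_le hq₀ hq₁ ha hα₀ hα₁ hm
    (f := fun x => ((r x : 𝕜) - lam * (w x : 𝕜)) * y x) hN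
  have hTa := hT 0
  rw [pow_zero, mul_one] at hTa
  have hφ : phi q a α (a * q ^ n) ≤ supNorm q a (phi q a α) :=
    (le_abs_self _).trans (norm_le_supNorm (exists_norm_phi_le hq₀ hq₁ ha hα₀ hα₁) hmem)
  have hA := norm_le_supNorm (exists_norm_coefA_le hq₀ hq₁ ha hα₀ hα₁ hm c₁ c₂ d₁ d₂) hmem
  have hB := norm_le_supNorm (exists_norm_coefB_le hq₀ hq₁ ha hα₀ hα₁ hm c₁ c₂ d₁ d₂) hmem
  have hA₀ := supNorm_nonneg q a (coefA q a α p c₁ c₂ d₁ d₂)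
  have hB₀ := supNorm_nonneg q a (coefB q a α p c₁ c₂ d₁ d₂)
  rw [h.apply_eq_coef hq₀ hq₁ ha hα₀ hα₁ hp hm hΔ hu hN n]
  have hA' := (norm_smul_le _ _).trans
    (mul_le_mul hA (h.norm_sub_le hq₀ hq₁ ha hN) (norm_nonneg _) hA₀)
  have hB' := (norm_smul_le _ _).trans (mul_le_mul hB hTa (norm_nonneg _) hB₀)
  have hT' := (hT n).trans (mul_le_mul_of_nonneg_left hφ (by positivity))
  refine (_root_.norm_sub_le _ _).trans ((add_le_add ((norm_add_le _ _).trans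
    (add_le_add hA' hB')) hT').trans (le_of_eq ?_))
  field_simp
  ring

/-- Under the smallness condition a solution of the homogeneous problem vanishes. -/
theorem SolvesWith.eqOn_zero {q a α : ℝ} (hq₀ : 0 < q) (hq₁ : q < 1) (ha : 0 < a)
    (hα₀ : 0 < α) (hα₁ : α < 1) {p r w : ℝ → ℝ} {c₁ c₂ d₁ d₂ : ℝ} {lam : 𝕜} {u y : ℝ → 𝕜}
    (hp : ∀ x ∈ gridStar q a, p x ≠ 0) (hΔ : bdet q a α p c₁ c₂ d₁ d₂ ≠ 0)
    (hbdd : ∃ C : ℝ, ∀ x ∈ gridStar q a, ‖(r x : 𝕜) - lam * (w x : 𝕜)‖ ≤ C)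
    (hlam : supNorm q a (fun x => (r x : 𝕜) - lam * (w x : 𝕜)) <
      mInf q a p / (supNorm q a (phi q a α) +
          supNorm q a (coefB q a α p c₁ c₂ d₁ d₂) * phi q a α a +
          supNorm q a (coefA q a α p c₁ c₂ d₁ d₂) * a * mInf q a p))
    (h : SolvesWith q a r w c₁ c₂ d₁ d₂ lam u y)
    (hu : Set.EqOn u (flux q a α p y) (gridStar q a)) : Set.EqOn y 0 (gridStar q a) := by
  have hquot := (supNorm_nonneg q a (fun x => (r x : 𝕜) - lam * (w x : 𝕜))).trans_lt hlam
  -- Positivity of m_p is hidden in the strict inequality: for m_p = 0 its right-hand side would be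
  -- 0, below no norm.
  have hm : 0 < mInf q a p := by
    refine (mInf_nonneg q a p).lt_of_ne fun h0 => ?_
    rw [← h0, zero_div] at hquot
    exact hquot.false
  have hden := (div_pos_iff_of_pos_left hm).1 hquot
  have hlim : Tendsto (fun n : ℕ => y (a * q ^ n)) atTop (𝓝 (y 0)) := by
    simpa using h.1.1 _ (mem_gridStar q a 0)
  -- Regularity at zero makes y convergent along the grid, so the supremum S is finite.
  have hbd : BddAbove (Set.range fun n : ℕ => ‖y (a * q ^ n)‖) := hlim.norm.bddAbove_range
  have hcon := ciSup_le fun n => h.norm_apply_le hq₀ hq₁ ha hα₀ hα₁ hp hm hΔ hbdd hu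
    (fun k => le_ciSup hbd k) n
  have hκ : supNorm q a (fun x => (r x : 𝕜) - lam * (w x : 𝕜)) *
      ((supNorm q a (phi q a α) + supNorm q a (coefB q a α p c₁ c₂ d₁ d₂) * phi q a α a +
        supNorm q a (coefA q a α p c₁ c₂ d₁ d₂) * a * mInf q a p) / mInf q a p) < 1 := by
    rw [lt_div_iff₀ hden] at hlam
    rwa [mul_div_assoc', div_lt_one hm]
  have hS₀ : 0 ≤ ⨆ n : ℕ, ‖y (a * q ^ n)‖ := Real.iSup_nonneg fun _ => norm_nonneg _
  have hS : ⨆ n : ℕ, ‖y (a * q ^ n)‖ = 0 := by nlinarith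
  have hy : ∀ n : ℕ, y (a * q ^ n) = 0 := fun n =>
    norm_le_zero_iff.1 ((le_ciSup hbd n).trans hS.le)
  rintro x (⟨n, rfl⟩ | hx)
  · exact hy n
  · rw [Set.mem_singleton_iff.1 hx]
    simp only [hy] at hlim
    exact tendsto_nhds_unique hlim tendsto_const_nhds

/-! ### The zero solution and the conclusion -/

theorem flux_zero (q a α : ℝ) (p : ℝ → ℝ) : flux q a α p (0 : ℝ → 𝕜) = 0 := by
  funext x
  simp [flux, leftCaputo, leftInt, qDeriv, rightInt, jackson, jackson₀]

theorem isSolution_zero (q a α : ℝ) (p r w : ℝ → ℝ) (c₁ c₂ d₁ d₂ : ℝ) (lam : 𝕜) :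
    IsSolution q a α p r w c₁ c₂ d₁ d₂ lam 0 := by
  rw [IsSolution, flux_zero]
  exact ⟨⟨fun x _ => by simp, 0, fun u _ N => by simp⟩,
    fun x _ => ⟨0, ⟨by simp, by simp⟩, by simp⟩, by simp, by simp⟩

theorem IsSolution.isSolutionExt {q a α : ℝ} {p r w : ℝ → ℝ} {c₁ c₂ d₁ d₂ : ℝ} {lam : 𝕜}
    {y : ℝ → 𝕜} (h : IsSolution q a α p r w c₁ c₂ d₁ d₂ lam y) :
    IsSolutionExt q a α p r w c₁ c₂ d₁ d₂ lam y :=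
  ⟨_, Set.eqOn_refl _ _, h⟩

/-- Once every solution vanishes on the grid, proportionality holds with factor 0. -/
theorem uniquelySolvable_and_simple {q a : ℝ} {Sol : (ℝ → 𝕜) → Prop} (h0 : Sol 0)
    (h : ∀ z, Sol z → Set.EqOn z 0 (gridStar q a)) :
    UniquelySolvable q a Sol ∧ SimpleIfEigenvalue q a Sol :=
  ⟨⟨0, h0, h⟩, fun y z _ hz => ⟨0, fun x hx => by simp [h z hz.1 hx]⟩⟩

end Problem

end

end QFSLP

theorem theorem3p6 {𝕜 : Type*} [RCLike 𝕜] (q a α : ℝ) (hq₀ : 0 < q) (hq₁ : q < 1) (ha : 0 < a)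
    (hα₀ : 0 < α) (hα₁ : α < 1) (p r w : ℝ → ℝ)
    (hp : ∀ x ∈ QFSLP.gridStar q a, p x ≠ 0) (hw : ∀ x ∈ QFSLP.gridStar q a, 0 < w x)
    (c₁ c₂ d₁ d₂ : ℝ) (hc : c₁ ^ 2 + c₂ ^ 2 ≠ 0) (hd : d₁ ^ 2 + d₂ ^ 2 ≠ 0)
    (hΔ : QFSLP.bdet q a α p c₁ c₂ d₁ d₂ ≠ 0) (lam : 𝕜)
    (hbdd : ∃ C : ℝ, ∀ x ∈ QFSLP.gridStar q a, ‖(r x : 𝕜) - lam * (w x : 𝕜)‖ ≤ C)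
    (hlam : QFSLP.supNorm q a (fun x => (r x : 𝕜) - lam * (w x : 𝕜)) <
      QFSLP.mInf q a p /
        (QFSLP.supNorm q a (QFSLP.phi q a α) +
          QFSLP.supNorm q a (QFSLP.coefB q a α p c₁ c₂ d₁ d₂) * QFSLP.phi q a α a +
          QFSLP.supNorm q a (QFSLP.coefA q a α p c₁ c₂ d₁ d₂) * a * QFSLP.mInf q a p)) :
    (QFSLP.UniquelySolvable q a (QFSLP.IsSolution q a α p r w c₁ c₂ d₁ d₂ lam) ∧
      QFSLP.SimpleIfEigenvalue q a (QFSLP.IsSolution q a α p r w c₁ c₂ d₁ d₂ lam)) ∧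
    (QFSLP.UniquelySolvable q a (QFSLP.IsSolutionExt q a α p r w c₁ c₂ d₁ d₂ lam) ∧
      QFSLP.SimpleIfEigenvalue q a (QFSLP.IsSolutionExt q a α p r w c₁ c₂ d₁ d₂ lam)) := by
  have hext : ∀ z, QFSLP.IsSolutionExt q a α p r w c₁ c₂ d₁ d₂ lam z →
      Set.EqOn z 0 (QFSLP.gridStar q a) := by
    rintro z ⟨u, hu, hz⟩
    exact hz.eqOn_zero hq₀ hq₁ ha hα₀ hα₁ hp hΔ hbdd hlam hu
  have h0 := QFSLP.isSolution_zero q a α p r w c₁ c₂ d₁ d₂ lam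
  exact ⟨QFSLP.uniquelySolvable_and_simple h0 fun z hz => hext z hz.isSolutionExt,
    QFSLP.uniquelySolvable_and_simple h0.isSolutionExt hext⟩
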